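/- Let $\mathcal H$ be a finite-dimensional complex Hilbert space and let $\rho,\sigma$ be strictly positive density matrices on $\mathcal H$. A reverse test of $\{\rho,\sigma\}$ is a triple $(\Phi,\{p,q\})$ of probability distributions $p,q$ on a finite set $\mathcal X$ (of any size), identified with diagonal density matrices, and a completely positive trace-preserving map $\Phi$ with $\Phi(p)=\rho$ and $\Phi(q)=\sigma$. Put $$F_{\min}(\rho,\sigma):=\max_{(\Phi,\{p,q\})}\ \sum_{x\in\mathcal X}\sqrt{p(x)}\sqrt{q(x)},$$ the maximum being over all reverse tests of $\{\rho,\sigma\}$. For a smooth path $\{\rho_t\}_{0\le t\le1}$ of strictly positive density matrices, let the right logarithmic derivative (RLD) $L^R_t$ be the unique solution of $\frac{d\rho_t}{dt}=L^R_t\rho_t$, and let $J^R_t:=\mathrm{tr}\,(L^R_t)^\dagger L^R_t\rho_t$ be the RLD Fisher information. Then the maximum defining $F_{\min}(\rho,\sigma)$ is attained, and $$F_{\min}(\rho,\sigma)=\cos\left(\min_C\frac12\int_0^1\sqrt{J^R_t}\,dt\right),$$ where the minimum, which is attained, is over all smooth ($C^\infty$) paths $C=\{\rho_t\}_{0\le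 t\le1}$ of strictly positive density matrices with $\rho_0=\rho$, $\rho_1=\sigma$ and $[L^R_s,L^R_t]=0$ for all $s,t\in[0,1]$. -/

import Mathlib

open scoped Matrix ContDiff ComplexOrder

noncomputable section

namespace QFid

/-- A strictly positive quantum state (an interior point of the state space). -/
def IsPosState {n : Type*} [Fintype n] (ρ : Matrix n n ℂ) : Prop :=
  ρ.PosDef ∧ ρ.trace = 1

/-- The amplification `id ⊗ Φ`, acting on `m × m` block matrices by applying `Φ` to each block. -/
def ampliation {k n : Type*} (m : ℕ) (Φ : Matrix k k ℂ →ₗ[ℂ] Matrix n n ℂ)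
    (A : Matrix (Fin m × k) (Fin m × k) ℂ) : Matrix (Fin m × n) (Fin m × n) ℂ :=
  Matrix.of fun a b => Φ (Matrix.of fun x y => A (a.1, x) (b.1, y)) a.2 b.2

/-- Completely positive trace-preserving maps between matrix algebras. -/
def IsCPTP {k n : Type*} [Fintype k] [Fintype n]
    (Φ : Matrix k k ℂ →ₗ[ℂ] Matrix n n ℂ) : Prop :=
  (∀ (m : ℕ) (A : Matrix (Fin m × k) (Fin m × k) ℂ),
      A.PosSemidef → (ampliation m Φ A).PosSemidef) ∧
    ∀ A : Matrix k k ℂ, (Φ A).trace = A.trace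

/-- A probability distribution, regarded as a diagonal density matrix. -/
def diagState {k : ℕ} (p : Fin k → ℝ) : Matrix (Fin k) (Fin k) ℂ :=
  Matrix.diagonal fun x => (p x : ℂ)

/-- Classical fidelity `∑ₓ √p(x) √q(x)`. -/
def classicalFidelity {k : ℕ} (p q : Fin k → ℝ) : ℝ :=
  ∑ x, √(p x) * √(q x)

/-- `(Φ, {p, q})` is a reverse test of `{ρ, σ}`. -/
structure IsReverseTest {n : Type*} [Fintype n] {k : ℕ}
    (Φ : Matrix (Fin k) (Fin k) ℂ →ₗ[ℂ] Matrix n n ℂ) (p q : Fin k → ℝ)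
    (ρ σ : Matrix n n ℂ) : Prop where
  cptp : IsCPTP Φ
  prob_left : p ∈ stdSimplex ℝ (Fin k)
  prob_right : q ∈ stdSimplex ℝ (Fin k)
  map_left : Φ (diagState p) = ρ
  map_right : Φ (diagState q) = σ

/-- The classical fidelities `F(p, q)` of all reverse tests of `{ρ, σ}`, over all finite
alphabets. -/
def reverseTestFidelities {n : Type*} [Fintype n] (ρ σ : Matrix n n ℂ) : Set ℝ :=
  {f | ∃ (k : ℕ) (Φ : Matrix (Fin k) (Fin k) ℂ →ₗ[ℂ] Matrix n n ℂ) (p q : Fin k → ℝ),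
    IsReverseTest Φ p q ρ σ ∧ f = classicalFidelity p q}

/-- `F_min(ρ, σ)`: the largest classical fidelity of a reverse test of `{ρ, σ}`. -/
def Fmin {n : Type*} [Fintype n] (ρ σ : Matrix n n ℂ) : ℝ :=
  sSup (reverseTestFidelities ρ σ)

/-- A smooth path `γ : [0, 1] → {strictly positive states}` from `ρ` to `σ`. Values outside
`[0, 1]` are irrelevant. -/
structure IsSmoothPath {n : Type*} [Fintype n] (γ : ℝ → Matrix n n ℂ)
    (ρ σ : Matrix n n ℂ) : Prop where
  smooth : ∀ i j, ContDiffOn ℝ ∞ (fun t => γ t i j) (Set.Icc 0 1)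
  state : ∀ t ∈ Set.Icc (0 : ℝ) 1, IsPosState (γ t)
  source : γ 0 = ρ
  target : γ 1 = σ

/-- The velocity `dγ/dt` on `[0, 1]`, one-sided at the end points. -/
def velocity {n : Type*} (γ : ℝ → Matrix n n ℂ) (t : ℝ) : Matrix n n ℂ :=
  Matrix.of fun i j => derivWithin (fun s => γ s i j) (Set.Icc 0 1) t

/-- `L` is the right logarithmic derivative of `γ` at `t`: `dγ/dt = L γ(t)`. It is unique when
`γ t` is strictly positive. -/
def IsRLD {n : Type*} [Fintype n] (γ : ℝ → Matrix n n ℂ) (t : ℝ) (L : Matrix n n ℂ) : Prop :=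
  velocity γ t = L * γ t

/-- RLD Fisher information `tr L† L ρ` (a real number). -/
def rldFisher {n : Type*} [Fintype n] (ρ L : Matrix n n ℂ) : ℝ :=
  (Lᴴ * L * ρ).trace.re

/-- The values `½ ∫₀¹ √(J^R_t) dt` over all smooth paths from `ρ` to `σ` whose RLDs commute at
all pairs of times. -/
def commutingRLDLengths {n : Type*} [Fintype n] (ρ σ : Matrix n n ℂ) : Set ℝ :=
  {l | ∃ γ L : ℝ → Matrix n n ℂ, IsSmoothPath γ ρ σ ∧
    (∀ t ∈ Set.Icc (0 : ℝ) 1, IsRLD γ t (L t)) ∧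
    (∀ s ∈ Set.Icc (0 : ℝ) 1, ∀ t ∈ Set.Icc (0 : ℝ) 1, L s * L t = L t * L s) ∧
    l = 1 / 2 * ∫ t in (0 : ℝ)..1, √(rldFisher (γ t) (L t))}

end QFid

end

namespace QFid

section Algebra

variable {n : Type*} [Fintype n]

/-- Operator monotonicity of the square root, for matrices. -/
lemma posSemidef_sub_of_sq {A Y : Matrix n n ℂ} (hA : A.PosSemidef) (hY : Y.IsHermitian)
    (h : (A * A - Y * Y).PosSemidef) : (A - Y).PosSemidef := by
  classical
  have hH : (A - Y).IsHermitian := hA.1.sub hY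
  rw [hH.posSemidef_iff_eigenvalues_nonneg]
  intro i
  by_contra hlt
  simp only [Pi.zero_apply, not_le] at hlt
  set l : ℝ := hH.eigenvalues i
  set v : n → ℂ := ⇑(hH.eigenvectorBasis i)
  have hv0 : v ≠ 0 := by
    intro h0
    apply hH.eigenvectorBasis.orthonormal.ne_zero i
    ext j
    exact congrFun h0 j
  have hv : (A - Y) *ᵥ v = (l : ℂ) • v := by
    rw [hH.mulVec_eigenvectorBasis i]
    rfl
  have hv' : star v ᵥ* (A - Y) = (l : ℂ) • star v := by
    have := congrArg star hv
    rwa [Matrix.star_mulVec, hH.eq, star_smul, RCLike.star_def, Complex.conj_ofReal] at this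
  have key : star v ⬝ᵥ ((A * A - Y * Y) *ᵥ v)
      = (l : ℂ) * (2 * (star v ⬝ᵥ (A *ᵥ v)) - l * (star v ⬝ᵥ v)) := by
    have e : A * A - Y * Y = (A - Y) * A + A * (A - Y) - (A - Y) * (A - Y) := by noncomm_ring
    rw [e, Matrix.sub_mulVec, Matrix.add_mulVec, dotProduct_sub, dotProduct_add,
      ← Matrix.mulVec_mulVec, ← Matrix.mulVec_mulVec, ← Matrix.mulVec_mulVec, hv,
      Matrix.dotProduct_mulVec (star v) (A - Y), hv', Matrix.dotProduct_mulVec (star v) (A - Y),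
      hv', Matrix.mulVec_smul]
    simp only [smul_dotProduct, dotProduct_smul, smul_eq_mul]
    ring
  have h1 := (Complex.nonneg_iff.1 (h.dotProduct_mulVec_nonneg v)).1
  have h2 := (Complex.nonneg_iff.1 (hA.dotProduct_mulVec_nonneg v)).1
  have h3 := (Complex.pos_iff.1 (Matrix.dotProduct_star_self_pos_iff.2 hv0)).1
  rw [key, Complex.re_ofReal_mul, Complex.sub_re, Complex.re_ofReal_mul,
    show (2 : ℂ) = ((2 : ℝ) : ℂ) by norm_num, Complex.re_ofReal_mul] at h1
  nlinarith [mul_pos_of_neg_of_neg hlt hlt, mul_pos (mul_pos_of_neg_of_neg hlt hlt) h3]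

lemma exists_unitary_diagonal [DecidableEq n] {M : Matrix n n ℂ} (hM : M.PosDef) :
    ∃ (U : Matrix n n ℂ) (d : n → ℝ), U * Uᴴ = 1 ∧ (∀ i, 0 < d i) ∧
      M = U * Matrix.diagonal (fun i => (d i : ℂ)) * Uᴴ :=
  ⟨hM.1.eigenvectorUnitary, hM.1.eigenvalues, Unitary.coe_mul_star_self hM.1.eigenvectorUnitary,
    hM.eigenvalues_pos, hM.1.spectral_theorem⟩

/-- Two positive definite Hermitian forms are simultaneously diagonalizable by congruence. -/
lemma exists_simultaneous_congruence [DecidableEq n] {ρ σ : Matrix n n ℂ} (hρ : ρ.PosDef)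
    (hσ : σ.PosDef) :
    ∃ (S : Matrix n n ℂ) (d : n → ℝ), IsUnit S ∧ (∀ i, 0 < d i) ∧ ρ = S * Sᴴ ∧
      σ = S * Matrix.diagonal (fun i => (d i : ℂ)) * Sᴴ := by
  obtain ⟨V, c, -, hc, hV⟩ := exists_unitary_diagonal hρ
  let R : Matrix n n ℂ := V * Matrix.diagonal (fun i => ((√(c i) : ℝ) : ℂ))
  have hR : ρ = R * Rᴴ := by
    simp only [hV, R, Matrix.conjTranspose_mul, Matrix.diagonal_conjTranspose, ← mul_assoc]
    rw [mul_assoc _ (Matrix.diagonal _) (Matrix.diagonal _), Matrix.diagonal_mul_diagonal]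
    congr 3
    ext i
    simp only [Pi.star_apply, RCLike.star_def, Complex.conj_ofReal]
    rw [← Complex.ofReal_mul, Real.mul_self_sqrt (hc i).le]
  have hRu : IsUnit R := by
    have : IsUnit (R * Rᴴ) := hR ▸ hρ.isUnit
    rw [Matrix.isUnit_iff_isUnit_det, Matrix.det_mul] at this
    rw [Matrix.isUnit_iff_isUnit_det]
    exact isUnit_of_mul_isUnit_left this
  have hRd := (Matrix.isUnit_iff_isUnit_det R).1 hRu
  have hRH : IsUnit Rᴴ.det := by rw [Matrix.det_conjTranspose]; exact hRd.star
  have hM : (R⁻¹ * σ * (R⁻¹)ᴴ).PosDef :=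
    (Matrix.IsUnit.posDef_star_right_conjugate_iff (U := R⁻¹) (x := σ)
      ((Matrix.isUnit_nonsing_inv_iff).2 hRu)).2 hσ
  obtain ⟨U, d, hUU, hd, hU⟩ := exists_unitary_diagonal hM
  refine ⟨R * U, d, hRu.mul (IsUnit.of_mul_eq_one _ hUU), hd, ?_, ?_⟩
  · rw [Matrix.conjTranspose_mul, mul_assoc, ← mul_assoc U, hUU, one_mul, hR]
  · have h' : R * (R⁻¹ * σ * (R⁻¹)ᴴ) * Rᴴ = σ := by
      rw [Matrix.conjTranspose_nonsing_inv]
      simp only [← mul_assoc]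
      rw [Matrix.mul_nonsing_inv _ hRd, one_mul, mul_assoc, Matrix.nonsing_inv_mul _ hRH, mul_one]
    rw [← h', hU, Matrix.conjTranspose_mul R U]
    simp only [mul_assoc]

/-- Maximality of the geometric mean `S √D Sᴴ` of `S Sᴴ` and `S D Sᴴ`, in trace form. -/
lemma trace_re_le_of_schur [DecidableEq n] {S X : Matrix n n ℂ} {d : n → ℝ} (hS : IsUnit S)
    (hd : ∀ i, 0 < d i) (hX : X.IsHermitian)
    (h : (S * Matrix.diagonal (fun i => (d i : ℂ)) * Sᴴ - X * (S * Sᴴ)⁻¹ * X).PosSemidef) :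
    X.trace.re ≤ (S * Matrix.diagonal (fun i => ((√(d i) : ℝ) : ℂ)) * Sᴴ).trace.re := by
  have hSd := (Matrix.isUnit_iff_isUnit_det S).1 hS
  have hSH : IsUnit Sᴴ.det := by rw [Matrix.det_conjTranspose]; exact hSd.star
  set E := Matrix.diagonal (fun i => ((√(d i) : ℝ) : ℂ)) with hE
  have hEE : E * E = Matrix.diagonal (fun i => (d i : ℂ)) := by
    rw [hE, Matrix.diagonal_mul_diagonal]
    congr 1
    ext i
    rw [← Complex.ofReal_mul, Real.mul_self_sqrt (hd i).le]
  have hEp : E.PosSemidef := Matrix.PosSemidef.diagonal fun i => by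
    simp [Real.sqrt_nonneg (d i)]
  let Y := S⁻¹ * X * (S⁻¹)ᴴ
  have hY : Y.IsHermitian := by
    simp only [Matrix.IsHermitian, Y, Matrix.conjTranspose_mul, Matrix.conjTranspose_conjTranspose,
      hX.eq, mul_assoc]
  have hXY : S * Y * Sᴴ = X := by
    simp only [Y, Matrix.conjTranspose_nonsing_inv, ← mul_assoc]
    rw [Matrix.mul_nonsing_inv _ hSd, one_mul, mul_assoc, Matrix.nonsing_inv_mul _ hSH, mul_one]
  have h2 : (E * E - Y * Y).PosSemidef := by
    have := h.mul_mul_conjTranspose_same S⁻¹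
    convert this using 1
    rw [hEE, mul_sub, sub_mul, Matrix.mul_inv_rev, ← Matrix.conjTranspose_nonsing_inv]
    congr 1
    · rw [Matrix.conjTranspose_nonsing_inv]
      simp only [← mul_assoc]
      rw [Matrix.nonsing_inv_mul _ hSd, one_mul, mul_assoc, Matrix.mul_nonsing_inv _ hSH, mul_one]
    · simp only [Y, mul_assoc]
  have h3 := ((posSemidef_sub_of_sq hEp hY h2).mul_mul_conjTranspose_same S).trace_nonneg
  rw [mul_sub, sub_mul, hXY, Matrix.trace_sub] at h3
  have := (Complex.nonneg_iff.1 h3).1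
  rw [Complex.sub_re] at this
  linarith

/-- The squared Euclidean norm of a column. -/
noncomputable def colNormSq (S : Matrix n n ℂ) (i : n) : ℝ := ∑ j, ‖S j i‖ ^ 2

lemma congruence_diagonal_apply [DecidableEq n] (S : Matrix n n ℂ) (f : n → ℂ) (i j : n) :
    (S * Matrix.diagonal f * Sᴴ) i j = ∑ x, f x * (S i x * star (S j x)) := by
  rw [Matrix.mul_apply]
  refine Finset.sum_congr rfl fun x _ => ?_
  rw [Matrix.mul_diagonal, Matrix.conjTranspose_apply]
  ring

lemma sum_mul_star_eq_colNormSq (S : Matrix n n ℂ) (i : n) :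
    ∑ j, S j i * star (S j i) = (colNormSq S i : ℂ) := by
  simp only [colNormSq, RCLike.star_def, Complex.mul_conj']
  push_cast
  rfl

lemma trace_congruence_diagonal [DecidableEq n] (S : Matrix n n ℂ) (f : n → ℝ) :
    (S * Matrix.diagonal (fun i => (f i : ℂ)) * Sᴴ).trace =
      ((∑ i, f i * colNormSq S i : ℝ) : ℂ) := by
  simp only [Matrix.trace, Matrix.diag_apply, congruence_diagonal_apply]
  rw [Finset.sum_comm]
  push_cast
  refine Finset.sum_congr rfl fun i _ => ?_
  rw [← Finset.mul_sum, sum_mul_star_eq_colNormSq]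

lemma colNormSq_pos [DecidableEq n] {S : Matrix n n ℂ} (hS : IsUnit S) (i : n) :
    0 < colNormSq S i := by
  refine lt_of_le_of_ne (Finset.sum_nonneg fun j _ => by positivity) fun h => ?_
  have hz := (Finset.sum_eq_zero_iff_of_nonneg (fun j _ => by positivity)).1 h.symm
  have hc : ∀ j, S j i = 0 := fun j => by simpa using hz j (Finset.mem_univ j)
  have h1 := congrFun (congrFun (Matrix.nonsing_inv_mul S
    ((Matrix.isUnit_iff_isUnit_det S).1 hS)) i) i
  rw [Matrix.mul_apply, Matrix.one_apply_eq] at h1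
  simp [hc] at h1

lemma sum_colNormSq [DecidableEq n] {S : Matrix n n ℂ} (h : (S * Sᴴ).trace = 1) :
    ∑ i, colNormSq S i = 1 := by
  have := trace_congruence_diagonal S fun _ => 1
  simp only [Complex.ofReal_one, Matrix.diagonal_one, mul_one, one_mul, h] at this
  exact Complex.ofReal_eq_one.1 this.symm

end Algebra

section ReverseTests

variable {n : Type*} [Fintype n]

/-- Every reverse test yields a Hermitian `X` with `[[ρ, X], [X, σ]] ≥ 0` whose trace is the
classical fidelity. -/
lemma IsReverseTest.exists_schur [DecidableEq n] {k : ℕ}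
    {Φ : Matrix (Fin k) (Fin k) ℂ →ₗ[ℂ] Matrix n n ℂ} {p q : Fin k → ℝ} {ρ σ : Matrix n n ℂ}
    (h : IsReverseTest Φ p q ρ σ) (hρ : ρ.PosDef) :
    ∃ X : Matrix n n ℂ, X.IsHermitian ∧ (σ - X * ρ⁻¹ * X).PosSemidef ∧
      X.trace.re = classicalFidelity p q := by
  let w : Fin 2 → Fin k → ℝ := ![fun x => √(p x), fun x => √(q x)]
  let B : Matrix (Fin 2 × Fin k) (Fin k) ℂ :=
    Matrix.of fun a x => if a.2 = x then (w a.1 x : ℂ) else 0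
  have hblock : ∀ i j, (Matrix.of fun x y => (B * Bᴴ) (i, x) (j, y)) =
      Matrix.diagonal fun x => ((w i x * w j x : ℝ) : ℂ) := by
    intro i j
    ext x y
    by_cases hxy : x = y
    · subst hxy
      simp [B, Matrix.mul_apply]
    · simp [B, Matrix.mul_apply, hxy, Ne.symm hxy]
  let X := Φ (Matrix.diagonal fun x => ((√(p x) * √(q x) : ℝ) : ℂ))
  have hpsd := (h.cptp.1 2 _ (Matrix.posSemidef_self_mul_conjTranspose B)).submatrix
    (Sum.elim (fun j : n => ((0 : Fin 2), j)) (fun j : n => ((1 : Fin 2), j)))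
  have h00 : Φ (Matrix.of fun x y => (B * Bᴴ) (0, x) (0, y)) = ρ := by
    rw [hblock, ← h.map_left, diagState]
    congr 3
    ext x
    simp [w, Real.mul_self_sqrt (h.prob_left.1 x)]
  have h11 : Φ (Matrix.of fun x y => (B * Bᴴ) (1, x) (1, y)) = σ := by
    rw [hblock, ← h.map_right, diagState]
    congr 3
    ext x
    simp [w, Real.mul_self_sqrt (h.prob_right.1 x)]
  have h01 : Φ (Matrix.of fun x y => (B * Bᴴ) (0, x) (1, y)) = X := by
    rw [hblock]
    rfl
  have h10 : Φ (Matrix.of fun x y => (B * Bᴴ) (1, x) (0, y)) = X := by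
    rw [hblock]
    simp only [X, w, Matrix.cons_val_one, Matrix.cons_val_zero, mul_comm]
  have hfb : (Matrix.fromBlocks ρ X X σ).PosSemidef := by
    convert hpsd using 1
    ext a b
    rcases a with a | a <;> rcases b with b | b <;>
      simp [ampliation, h00, h01, h10, h11]
  have hX : X.IsHermitian := by
    have := hfb.1
    rw [Matrix.isHermitian_fromBlocks_iff] at this
    have h2 := this.2.1
    exact h2
  refine ⟨X, hX, ?_, ?_⟩
  · have : Invertible ρ := hρ.isUnit.invertible
    have := (Matrix.PosDef.fromBlocks₁₁ X σ hρ).1 (by rw [hX.eq]; exact hfb)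
    rwa [hX.eq] at this
  · simp only [X, h.cptp.2, Matrix.trace_diagonal, classicalFidelity, Complex.re_sum,
      Complex.ofReal_re]

/-- The map that measures the computational basis and prepares `τ x` on outcome `x`. -/
noncomputable def prepareMap {k : ℕ} (τ : Fin k → Matrix n n ℂ) :
    Matrix (Fin k) (Fin k) ℂ →ₗ[ℂ] Matrix n n ℂ where
  toFun A := ∑ x, A x x • τ x
  map_add' A B := by simp [add_smul, Finset.sum_add_distrib]
  map_smul' c A := by simp [Finset.smul_sum, smul_smul]

open Kronecker in
lemma isCPTP_prepareMap {k : ℕ} {τ : Fin k → Matrix n n ℂ} (hτ : ∀ x, (τ x).PosSemidef)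
    (hτ1 : ∀ x, (τ x).trace = 1) : IsCPTP (prepareMap τ) := by
  refine ⟨fun m A hA => ?_, fun A => ?_⟩
  · have : ampliation m (prepareMap τ) A =
        ∑ x, (A.submatrix (fun i => (i, x)) (fun i => (i, x))) ⊗ₖ τ x := by
      ext a b
      simp [ampliation, prepareMap, Matrix.sum_apply, Matrix.kroneckerMap_apply]
    rw [this]
    exact Matrix.posSemidef_sum _ fun x _ => (hA.submatrix _).kronecker (hτ x)
  · simp only [prepareMap, LinearMap.coe_mk, AddHom.coe_mk, Matrix.trace_sum, Matrix.trace_smul, hτ1,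
      smul_eq_mul, mul_one]
    rfl

lemma exists_reverseTest [DecidableEq n] {S : Matrix n n ℂ} {d : n → ℝ} (hS : IsUnit S)
    (hd : ∀ i, 0 < d i) (hρ : (S * Sᴴ).trace = 1)
    (hσ : (S * Matrix.diagonal (fun i => (d i : ℂ)) * Sᴴ).trace = 1) :
    (S * Matrix.diagonal (fun i => ((√(d i) : ℝ) : ℂ)) * Sᴴ).trace.re ∈
      reverseTestFidelities (S * Sᴴ) (S * Matrix.diagonal (fun i => (d i : ℂ)) * Sᴴ) := by
  let e := Fintype.equivFin n
  have ha : ∀ i, 0 < colNormSq S i := colNormSq_pos hS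
  let τ : Fin (Fintype.card n) → Matrix n n ℂ := fun x =>
    (((colNormSq S (e.symm x))⁻¹ : ℝ) : ℂ) • Matrix.vecMulVec (fun j => S j (e.symm x))
      (star fun j => S j (e.symm x))
  have hmap : ∀ f : n → ℝ,
      prepareMap τ (diagState fun x => f (e.symm x) * colNormSq S (e.symm x)) =
        S * Matrix.diagonal (fun i => (f i : ℂ)) * Sᴴ := by
    intro f
    ext j j'
    rw [congruence_diagonal_apply]
    simp only [prepareMap, LinearMap.coe_mk, AddHom.coe_mk, diagState, Matrix.diagonal_apply_eq,
      Matrix.sum_apply, Matrix.smul_apply, τ, Matrix.vecMulVec_apply, Pi.star_apply, smul_eq_mul]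
    rw [Equiv.sum_comp e.symm (fun i => ((f i * colNormSq S i : ℝ) : ℂ) *
      ((((colNormSq S i)⁻¹ : ℝ) : ℂ) * (S j i * star (S j' i))))]
    refine Finset.sum_congr rfl fun i _ => ?_
    have := (Complex.ofReal_ne_zero).2 (ha i).ne'
    push_cast
    field_simp
  refine ⟨Fintype.card n, prepareMap τ, fun x => colNormSq S (e.symm x),
    fun x => d (e.symm x) * colNormSq S (e.symm x),
    ⟨isCPTP_prepareMap ?_ ?_, ⟨?_, ?_⟩, ⟨?_, ?_⟩, ?_, ?_⟩, ?_⟩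
  · intro x
    refine (Matrix.posSemidef_vecMulVec_self_star _).smul ?_
    exact_mod_cast inv_nonneg.2 (ha _).le
  · intro x
    have : (Matrix.vecMulVec (fun j => S j (e.symm x)) (star fun j => S j (e.symm x))).trace =
        (colNormSq S (e.symm x) : ℂ) := sum_mul_star_eq_colNormSq S (e.symm x)
    rw [Matrix.trace_smul, this, smul_eq_mul, Complex.ofReal_inv,
      inv_mul_cancel₀ (Complex.ofReal_ne_zero.2 (ha _).ne')]
  · exact fun x => (ha _).le
  · exact (Equiv.sum_comp e.symm (colNormSq S)).trans (sum_colNormSq hρ)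
  · exact fun x => (mul_pos (hd _) (ha _)).le
  · rw [Equiv.sum_comp e.symm (fun i => d i * colNormSq S i)]
    rw [trace_congruence_diagonal] at hσ
    exact Complex.ofReal_eq_one.1 hσ
  · have := hmap fun _ => 1
    simpa only [one_mul, Complex.ofReal_one, Matrix.diagonal_one, mul_one] using this
  · rw [hmap]
  · rw [trace_congruence_diagonal, Complex.ofReal_re, classicalFidelity,
      Equiv.sum_comp e.symm (fun i => √(colNormSq S i) * √(d i * colNormSq S i))]
    refine Finset.sum_congr rfl fun i _ => ?_
    rw [Real.sqrt_mul (hd i).le, mul_left_comm, Real.mul_self_sqrt (ha i).le]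

end ReverseTests

section Geodesic

/-- The great circle arc from `1` to `s` on the unit sphere of the weighted space `ℓ²(a)`. -/
lemma exists_sphere_arc {n : Type*} [Fintype n] {a s : n → ℝ} (ha : ∀ i, 0 < a i)
    (hs : ∀ i, 0 < s i) (ha1 : ∑ i, a i = 1) (hs1 : ∑ i, s i ^ 2 * a i = 1) :
    ∃ r r' : ℝ → n → ℝ, (∀ i, ContDiff ℝ ∞ fun t => r t i) ∧
      (∀ t i, HasDerivAt (fun t => r t i) (r' t i) t) ∧ (∀ i, r 0 i = 1) ∧ (∀ i, r 1 i = s i) ∧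
      (∀ t ∈ Set.Icc (0 : ℝ) 1, ∀ i, 0 < r t i) ∧ (∀ t, ∑ i, r t i ^ 2 * a i = 1) ∧
      ∀ t, ∑ i, r' t i ^ 2 * a i = Real.arccos (∑ i, s i * a i) ^ 2 := by
  set F := ∑ i, s i * a i with hF
  have hsq : ∑ i, (s i - 1) ^ 2 * a i = 2 - 2 * F := by
    calc ∑ i, (s i - 1) ^ 2 * a i = ∑ i, (s i ^ 2 * a i - 2 * (s i * a i) + a i) :=
          Finset.sum_congr rfl fun i _ => by ring
      _ = 2 - 2 * F := by
          rw [Finset.sum_add_distrib, Finset.sum_sub_distrib, ← Finset.mul_sum, hs1, ha1, ← hF]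
          ring
  have hF1 : F ≤ 1 := by
    have : 0 ≤ ∑ i, (s i - 1) ^ 2 * a i :=
      Finset.sum_nonneg fun i _ => mul_nonneg (sq_nonneg _) (ha i).le
    linarith
  have hF0 : 0 ≤ F := Finset.sum_nonneg fun i _ => (mul_pos (hs i) (ha i)).le
  set θ := Real.arccos F with hθ
  have hcos : Real.cos θ = F := Real.cos_arccos (by linarith) hF1
  have hθ0 : 0 ≤ θ := Real.arccos_nonneg F
  have hθπ : θ ≤ Real.pi / 2 := Real.arccos_le_pi_div_two.2 hF0
  have hpi := Real.pi_pos
  have hsin0 : Real.sin θ = 0 → θ = 0 := fun h => by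
    by_contra hne
    have := Real.sin_pos_of_pos_of_lt_pi (lt_of_le_of_ne hθ0 (Ne.symm hne)) (by linarith)
    linarith
  let w : n → ℝ := fun i => (s i - F) / Real.sin θ
  have hw : ∀ i, Real.sin θ * w i = s i - F := by
    intro i
    by_cases h : Real.sin θ = 0
    · have hFe : F = 1 := by rw [← hcos, hsin0 h, Real.cos_zero]
      rw [hFe] at hsq
      have h0 := (Finset.sum_eq_zero_iff_of_nonneg
        (fun i _ => mul_nonneg (sq_nonneg _) (ha i).le)).1 (hsq.trans (by ring)) i
        (Finset.mem_univ i)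
      have : s i - 1 = 0 := by
        rcases mul_eq_zero.1 h0 with h | h
        · exact pow_eq_zero_iff (two_ne_zero) |>.1 h
        · exact absurd h (ha i).ne'
      rw [h, zero_mul, hFe, this]
    · simp only [w]
      field_simp
  have hw1 : ∑ i, w i * a i = 0 := by
    calc ∑ i, w i * a i = (∑ i, (s i * a i - F * a i)) / Real.sin θ := by
          rw [Finset.sum_div]
          exact Finset.sum_congr rfl fun i _ => by simp only [w]; ring
      _ = 0 := by rw [Finset.sum_sub_distrib, ← Finset.mul_sum, ha1, ← hF]; simp
  have hw2 : Real.sin θ ≠ 0 → ∑ i, w i ^ 2 * a i = 1 := by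
    intro h
    have h1 : ∑ i, w i ^ 2 * a i =
        (∑ i, (s i ^ 2 * a i - 2 * F * (s i * a i) + F ^ 2 * a i)) / Real.sin θ ^ 2 := by
      rw [Finset.sum_div]
      exact Finset.sum_congr rfl fun i _ => by simp only [w]; field_simp; ring
    rw [h1, Finset.sum_add_distrib, Finset.sum_sub_distrib, ← Finset.mul_sum, ← Finset.mul_sum,
      ha1, hs1, ← hF, div_eq_one_iff_eq (pow_ne_zero 2 h), Real.sin_sq, hcos]
    ring
  have hcomb : ∀ x y : ℝ, ∑ i, (x + y * w i) ^ 2 * a i = x ^ 2 + y ^ 2 * ∑ i, w i ^ 2 * a i := by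
    intro x y
    calc ∑ i, (x + y * w i) ^ 2 * a i
        = ∑ i, (x ^ 2 * a i + 2 * x * y * (w i * a i) + y ^ 2 * (w i ^ 2 * a i)) :=
          Finset.sum_congr rfl fun i _ => by ring
      _ = _ := by
          rw [Finset.sum_add_distrib, Finset.sum_add_distrib, ← Finset.mul_sum, ← Finset.mul_sum,
            ← Finset.mul_sum, ha1, hw1]
          ring
  refine ⟨fun t i => Real.cos (t * θ) + Real.sin (t * θ) * w i,
    fun t i => -(θ * Real.sin (t * θ)) + (θ * Real.cos (t * θ)) * w i, ?_, ?_, ?_, ?_, ?_, ?_, ?_⟩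
  · intro i
    fun_prop
  · intro t i
    have h1 : HasDerivAt (fun t : ℝ => t * θ) θ t := by
      simpa using (hasDerivAt_id t).mul_const θ
    convert! (h1.cos).add ((h1.sin).mul_const (w i)) using 1
    ring
  · intro i
    simp
  · intro i
    simp only [one_mul, hcos, hw]
    ring
  · intro t ht i
    by_cases h : Real.sin θ = 0
    · simp [hsin0 h]
    · have hθp : 0 < θ := lt_of_le_of_ne hθ0 fun h0 => h (by rw [← h0, Real.sin_zero])
      have hsp : 0 < Real.sin θ := Real.sin_pos_of_pos_of_lt_pi hθp (by linarith)
      refine pos_of_mul_pos_right (a := Real.sin θ) ?_ hsp.le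
      have e : Real.sin θ * (Real.cos (t * θ) + Real.sin (t * θ) * w i) =
          Real.sin (θ - t * θ) + Real.sin (t * θ) * s i := by
        rw [Real.sin_sub, hcos]
        linear_combination Real.sin (t * θ) * hw i
      rw [e]
      have hb : t * θ ≤ θ := mul_le_of_le_one_left hθ0 ht.2
      have hb0 : 0 ≤ t * θ := mul_nonneg ht.1 hθ0
      have h2 : 0 ≤ Real.sin (t * θ) := Real.sin_nonneg_of_nonneg_of_le_pi hb0 (by linarith)
      rcases ht.2.lt_or_eq with hlt | rfl
      · have : t * θ < θ := mul_lt_of_lt_one_left hθp hlt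
        have := Real.sin_pos_of_pos_of_lt_pi (x := θ - t * θ) (by linarith) (by linarith)
        have := mul_nonneg h2 (hs i).le
        linarith
      · simpa using mul_pos hsp (hs i)
  · intro t
    rw [hcomb]
    by_cases h : Real.sin θ = 0
    · simp [hsin0 h]
    · rw [hw2 h, mul_one, Real.cos_sq_add_sin_sq]
  · intro t
    rw [hcomb]
    by_cases h : Real.sin θ = 0
    · simp [hsin0 h]
    · rw [hw2 h]
      linear_combination θ ^ 2 * Real.sin_sq_add_cos_sq (t * θ)

variable {n : Type*} [Fintype n]

lemma exists_commuting_path [DecidableEq n] {S : Matrix n n ℂ} {d : n → ℝ} (hS : IsUnit S)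
    (hd : ∀ i, 0 < d i) (hρ : (S * Sᴴ).trace = 1)
    (hσ : (S * Matrix.diagonal (fun i => (d i : ℂ)) * Sᴴ).trace = 1) :
    Real.arccos (S * Matrix.diagonal (fun i => ((√(d i) : ℝ) : ℂ)) * Sᴴ).trace.re ∈
      commutingRLDLengths (S * Sᴴ) (S * Matrix.diagonal (fun i => (d i : ℂ)) * Sᴴ) := by
  have hsumσ : ∑ i, √(d i) ^ 2 * colNormSq S i = 1 := by
    rw [trace_congruence_diagonal] at hσ
    simpa only [Real.sq_sqrt (hd _).le] using Complex.ofReal_eq_one.1 hσ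
  obtain ⟨r, r', hsm, hder, hr0, hr1, hrpos, hrn, hr'n⟩ := exists_sphere_arc
    (colNormSq_pos hS) (fun i => Real.sqrt_pos.2 (hd i)) (sum_colNormSq hρ) hsumσ
  have hSd := (Matrix.isUnit_iff_isUnit_det S).1 hS
  have hSH : IsUnit Sᴴ.det := by rw [Matrix.det_conjTranspose]; exact hSd.star
  let D : (n → ℝ) → Matrix n n ℂ := fun f => Matrix.diagonal (fun i => (f i : ℂ))
  have hDD : ∀ f g, D f * D g = D fun i => f i * g i := by
    intro f g
    simp [D, Matrix.diagonal_mul_diagonal]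
  have hDH : ∀ f, (D f)ᴴ = D f := by
    intro f
    simp only [D, Matrix.diagonal_conjTranspose]
    congr 1
    ext i
    simp
  let γ : ℝ → Matrix n n ℂ := fun t => S * D (fun i => r t i ^ 2) * Sᴴ
  let L : ℝ → Matrix n n ℂ := fun t => S * D (fun i => 2 * r' t i / r t i) * S⁻¹
  have hentry : ∀ f i j, (S * D f * Sᴴ) i j = ∑ x, (f x : ℂ) * (S i x * star (S j x)) :=
    fun f i j => congruence_diagonal_apply S _ i j
  have hLγ : ∀ t ∈ Set.Icc (0 : ℝ) 1, L t * γ t = S * D (fun i => 2 * r t i * r' t i) * Sᴴ := by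
    intro t ht
    have : L t * γ t = S * (D (fun i => 2 * r' t i / r t i) * (S⁻¹ * S) *
        D (fun i => r t i ^ 2)) * Sᴴ := by simp only [L, γ, mul_assoc]
    rw [this, Matrix.nonsing_inv_mul _ hSd, mul_one, hDD]
    congr 4
    ext i
    have := (hrpos t ht i).ne'
    field_simp
  refine ⟨γ, L, ⟨?_, ?_, ?_, ?_⟩, ?_, ?_, ?_⟩
  · intro i j
    simp only [γ, hentry]
    refine ContDiff.contDiffOn (ContDiff.sum fun x _ => ContDiff.mul ?_ contDiff_const)
    exact Complex.ofRealCLM.contDiff.comp ((hsm x).pow 2)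
  · intro t ht
    refine ⟨?_, ?_⟩
    · refine (Matrix.IsUnit.posDef_star_right_conjugate_iff hS).2 ?_
      refine Matrix.PosDef.diagonal fun i => ?_
      exact_mod_cast pow_pos (hrpos t ht i) 2
    · simp only [γ, D]
      rw [trace_congruence_diagonal S fun i => r t i ^ 2]
      exact_mod_cast hrn t
  · simp [γ, D, hr0]
  · simp only [γ, D, hr1, Real.sq_sqrt (hd _).le]
  · intro t ht
    rw [IsRLD, hLγ t ht]
    ext i j
    rw [hentry]
    simp only [velocity, Matrix.of_apply, γ, hentry]
    refine HasDerivWithinAt.derivWithin ?_ (uniqueDiffOn_Icc_zero_one t ht)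
    refine HasDerivAt.hasDerivWithinAt (HasDerivAt.fun_sum fun x _ => HasDerivAt.mul_const ?_ _)
    have := ((hder t x).pow 2).ofReal_comp
    convert! this using 1
    push_cast
    ring
  · intro s _ t _
    have : ∀ f g, S * D f * S⁻¹ * (S * D g * S⁻¹) = S * D (fun i => f i * g i) * S⁻¹ := by
      intro f g
      have : S * D f * S⁻¹ * (S * D g * S⁻¹) = S * (D f * (S⁻¹ * S) * D g) * S⁻¹ := by
        simp only [mul_assoc]
      rw [this, Matrix.nonsing_inv_mul _ hSd, mul_one, hDD]
    simp only [L, this, mul_comm]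
  · have hJ : ∀ t ∈ Set.uIcc (0 : ℝ) 1, √(rldFisher (γ t) (L t)) =
        2 * Real.arccos (∑ i, √(d i) * colNormSq S i) := by
      intro t ht
      rw [Set.uIcc_of_le zero_le_one] at ht
      have h1 : (L t * γ t) * (L t)ᴴ = S * D (fun i => (2 * r' t i) ^ 2) * Sᴴ := by
        have : (L t * γ t) * (L t)ᴴ = S * (D (fun i => 2 * r t i * r' t i) * (Sᴴ * (Sᴴ)⁻¹) *
            D (fun i => 2 * r' t i / r t i)) * Sᴴ := by
          rw [hLγ t ht]
          simp only [L, Matrix.conjTranspose_mul, Matrix.conjTranspose_nonsing_inv, hDH, mul_assoc]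
        rw [this, Matrix.mul_nonsing_inv _ hSH, mul_one, hDD]
        congr 4
        ext i
        have := (hrpos t ht i).ne'
        field_simp
      have h2 : rldFisher (γ t) (L t) = (2 * Real.arccos (∑ i, √(d i) * colNormSq S i)) ^ 2 := by
        rw [rldFisher, mul_assoc, Matrix.trace_mul_comm, h1]
        simp only [D]
        rw [trace_congruence_diagonal S fun i => (2 * r' t i) ^ 2, Complex.ofReal_re, mul_pow, ← hr'n t, Finset.mul_sum]
        exact Finset.sum_congr rfl fun i _ => by ring
      rw [h2, Real.sqrt_sq (mul_nonneg zero_le_two (Real.arccos_nonneg _))]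
    rw [intervalIntegral.integral_congr hJ, trace_congruence_diagonal S fun i => √(d i), Complex.ofReal_re]
    simp

end Geodesic

section Transport

open NormedSpace MeasureTheory

lemma hasDerivAt_exp_of_commute {𝔸 : Type*} [NormedRing 𝔸] [NormedAlgebra ℝ 𝔸] [CompleteSpace 𝔸]
    {K : ℝ → 𝔸} {k : 𝔸} {t : ℝ} (hK : HasDerivAt K k t) (hc : ∀ s, Commute (K t) (K s)) :
    HasDerivAt (fun s => exp (K s)) (exp (K t) * k) t := by
  let _ : NormedAlgebra ℚ 𝔸 := .restrictScalars ℚ ℝ 𝔸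
  have h : ∀ s, exp (K s) = exp (K t) * exp (K s - K t) := fun s => by
    rw [← exp_add_of_commute ((hc s).sub_right (Commute.refl _)), add_sub_cancel]
  have h0 : HasFDerivAt exp (1 : 𝔸 →L[ℝ] 𝔸) (K t - K t) := by
    rw [sub_self]; exact hasFDerivAt_exp_zero
  have h1 : HasDerivAt (fun s => exp (K s - K t)) k t := by
    have := h0.comp_hasDerivAt t (hK.sub_const (K t))
    exact this
  simpa only [← h] using h1.const_mul (exp (K t))

/-- A path of self-adjoint elements whose logarithmic derivatives `ℓ` commute has the form
`N(t)² γ(0)` with `N' = ½ ℓ N`, where `N(t)` is self-adjoint relative to `γ(0)`. -/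
lemma exists_transport {𝔸 : Type*} [NormedRing 𝔸] [NormedAlgebra ℝ 𝔸] [CompleteSpace 𝔸]
    [StarRing 𝔸] [ContinuousStar 𝔸] [StarModule ℝ 𝔸] {ℓ γ : ℝ → 𝔸} (hℓ : Continuous ℓ)
    (hc : ∀ s t, Commute (ℓ s) (ℓ t))
    (hγ : ∀ t ∈ Set.Icc (0 : ℝ) 1, HasDerivWithinAt γ (ℓ t * γ t) (Set.Icc 0 1) t)
    (hsa : ∀ t ∈ Set.Icc (0 : ℝ) 1, IsSelfAdjoint (ℓ t * γ t))
    (hsa' : ∀ t ∈ Set.Icc (0 : ℝ) 1, IsSelfAdjoint (γ t)) :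
    ∃ N : ℝ → 𝔸, N 0 = 1 ∧ (∀ t, HasDerivAt N ((1 / 2 : ℝ) • (ℓ t * N t)) t) ∧
      ∀ t ∈ Set.Icc (0 : ℝ) 1, γ t = N t * N t * γ 0 ∧ N t * γ 0 = γ 0 * star (N t) := by
  let _ : NormedAlgebra ℚ 𝔸 := .restrictScalars ℚ ℝ 𝔸
  have hint : ∀ a b, IntervalIntegrable ℓ volume a b := fun a b => hℓ.intervalIntegrable a b
  let K : ℝ → 𝔸 := fun t => (1 / 2 : ℝ) • ∫ s in (0 : ℝ)..t, ℓ s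
  have hK : ∀ t, HasDerivAt K ((1 / 2 : ℝ) • ℓ t) t := fun t =>
    (intervalIntegral.integral_hasDerivAt_right (hint 0 t) (hℓ.stronglyMeasurableAtFilter _ _)
      hℓ.continuousAt).const_smul (1 / 2 : ℝ)
  have hcomm : ∀ a : 𝔸, (∀ s, Commute a (ℓ s)) → ∀ t, Commute a (K t) := by
    intro a ha t
    refine Commute.smul_right ?_ _
    have h1 := ContinuousLinearMap.intervalIntegral_comp_comm (ContinuousLinearMap.mul ℝ 𝔸 a)
      (hint 0 t)
    have h2 := ContinuousLinearMap.intervalIntegral_comp_comm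
      ((ContinuousLinearMap.mul ℝ 𝔸).flip a) (hint 0 t)
    simp only [ContinuousLinearMap.mul_apply', ContinuousLinearMap.flip_apply] at h1 h2
    rw [commute_iff_eq, ← h1, ← h2]
    exact intervalIntegral.integral_congr fun s _ => (ha s).eq
  have hℓK : ∀ s t, Commute (ℓ s) (K t) := fun s t => hcomm _ (hc s) t
  have hKK : ∀ s t, Commute (K s) (K t) := fun s t => hcomm _ (fun r => (hℓK r s).symm) t
  let N : ℝ → 𝔸 := fun t => exp (K t)
  let M : ℝ → 𝔸 := fun t => exp (-K t)
  have hNM : ∀ t, N t * M t = 1 := fun t => by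
    simp only [N, M]
    rw [← exp_add_of_commute (Commute.refl (K t)).neg_right, add_neg_cancel, exp_zero]
  have hℓN : ∀ s t, Commute (ℓ s) (N t) := fun s t => (hℓK s t).exp_right
  have hℓM : ∀ s t, Commute (ℓ s) (M t) := fun s t => (hℓK s t).neg_right.exp_right
  have hN : ∀ t, HasDerivAt N ((1 / 2 : ℝ) • (ℓ t * N t)) t := fun t => by
    have := hasDerivAt_exp_of_commute (hK t) (hKK t)
    rwa [mul_smul_comm, ← (hℓN t t).eq] at this
  have hM : ∀ t, HasDerivAt M (-((1 / 2 : ℝ) • (M t * ℓ t))) t := fun t => by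
    have := hasDerivAt_exp_of_commute (hK t).neg fun s => ((hKK t s).neg_right).neg_left
    rwa [mul_neg, mul_smul_comm] at this
  have hMN : ∀ t, M t * N t = 1 := fun t => by
    simp only [N, M]
    rw [← exp_add_of_commute (Commute.refl (K t)).neg_left, neg_add_cancel, exp_zero]
  have hN0 : N 0 = 1 := by simp [N, K]
  have hM0 : M 0 = 1 := by simp [M, K]
  have hconst : ∀ t ∈ Set.Icc (0 : ℝ) 1, M t * M t * γ t = γ 0 := by
    have hd : ∀ t ∈ Set.Icc (0 : ℝ) 1,
        HasDerivWithinAt (fun t => M t * M t * γ t) 0 (Set.Icc 0 1) t := by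
      intro t ht
      have := (((hM t).fun_mul (hM t)).hasDerivWithinAt (s := Set.Icc 0 1)).fun_mul (hγ t ht)
      convert! this using 1
      have e : M t * (M t * ℓ t) = M t * ℓ t * M t := by rw [mul_assoc (M t), (hℓM t t).eq]
      have e2 : M t * M t * (ℓ t * γ t) = M t * ℓ t * M t * γ t := by
        rw [← e]; simp only [mul_assoc]
      rw [e2, neg_mul, mul_neg, smul_mul_assoc, mul_smul_comm, e, ← neg_add, ← add_smul, neg_mul,
        smul_mul_assoc]
      norm_num
    intro t ht
    have := constant_of_derivWithin_zero (fun t ht => (hd t ht).differentiableWithinAt)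
      (fun t ht => (hd t (Set.Ico_subset_Icc_self ht)).derivWithin
        (uniqueDiffOn_Icc_zero_one t (Set.Ico_subset_Icc_self ht))) t ht
    simpa [hM0] using this
  have hγN : ∀ t ∈ Set.Icc (0 : ℝ) 1, γ t = N t * N t * γ 0 := by
    intro t ht
    rw [← hconst t ht]
    calc γ t = N t * (N t * M t) * M t * γ t := by rw [hNM, mul_one, hNM, one_mul]
      _ = _ := by simp only [mul_assoc]
  have hℓρ : ∀ t ∈ Set.Icc (0 : ℝ) 1, ℓ t * γ 0 = γ 0 * star (ℓ t) := by
    intro t ht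
    have h1 := (hsa t ht).star_eq
    rw [star_mul, (hsa' t ht).star_eq, hγN t ht, ← mul_assoc (ℓ t), ← mul_assoc (ℓ t),
      (hℓN t t).eq, mul_assoc (N t) (ℓ t), (hℓN t t).eq] at h1
    have h2 := congrArg (fun x => M t * (M t * x)) h1
    simp only [← mul_assoc] at h2
    rw [mul_assoc (M t) (M t) (N t), hMN, mul_one, hMN, one_mul, one_mul] at h2
    exact h2.symm
  have hKρ : ∀ t ∈ Set.Icc (0 : ℝ) 1, K t * γ 0 = γ 0 * star (K t) := by
    intro t ht
    simp only [K, star_smul, smul_mul_assoc, mul_smul_comm, star_trivial]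
    congr 1
    have h1 := ContinuousLinearMap.intervalIntegral_comp_comm
      ((ContinuousLinearMap.mul ℝ 𝔸).flip (γ 0)) (hint 0 t)
    have h2 := ContinuousLinearMap.intervalIntegral_comp_comm
      ((ContinuousLinearMap.mul ℝ 𝔸 (γ 0)).comp ((starL' ℝ : 𝔸 ≃L[ℝ] 𝔸) : 𝔸 →L[ℝ] 𝔸)) (hint 0 t)
    simp only [ContinuousLinearMap.mul_apply', ContinuousLinearMap.flip_apply,
      ContinuousLinearMap.comp_apply, ContinuousLinearEquiv.coe_coe, starL'_apply] at h1 h2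
    rw [← h1, ← h2]
    refine intervalIntegral.integral_congr fun s hs => hℓρ s ?_
    rw [Set.uIcc_of_le ht.1] at hs
    exact ⟨hs.1, hs.2.trans ht.2⟩
  refine ⟨N, hN0, hN, fun t ht => ⟨hγN t ht, ?_⟩⟩
  have h : SemiconjBy (γ 0) (star (K t)) (K t) := (hKρ t ht).symm
  have := h.exp_right.eq
  rw [← star_exp] at this
  exact this.symm

/-- A curve on the unit sphere is at least as long as the angle it subtends: `c` is the inner
product with the starting point, `f` the speed. -/
lemma arccos_le_integral_of_sphere {c c' f : ℝ → ℝ} (hf : Continuous f) (hf0 : ∀ t, 0 ≤ f t)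
    (hc : ∀ t, HasDerivAt c (c' t) t) (h0 : c 0 = 1)
    (hc1 : ∀ t ∈ Set.Icc (0 : ℝ) 1, c t ^ 2 ≤ 1)
    (hcf : ∀ t ∈ Set.Icc (0 : ℝ) 1, c' t ^ 2 ≤ f t ^ 2 * (1 - c t ^ 2)) :
    Real.arccos (c 1) ≤ ∫ t in (0 : ℝ)..1, f t := by
  have key : ∀ r ∈ Set.Ioo (0 : ℝ) 1,
      Real.arccos (r * c 1) - Real.arccos r ≤ ∫ t in (0 : ℝ)..1, f t := by
    intro r hr
    let g : ℝ → ℝ := fun t => (∫ s in (0 : ℝ)..t, f s) - Real.arccos (r * c t)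
    have hr2 : r ^ 2 < 1 := by nlinarith [hr.1, hr.2]
    have hlt : ∀ t ∈ Set.Icc (0 : ℝ) 1, (r * c t) ^ 2 < 1 := by
      intro t ht
      rw [mul_pow]
      nlinarith [hc1 t ht, sq_nonneg (c t), sq_nonneg r]
    have hI : ∀ t, HasDerivAt (fun t => ∫ s in (0 : ℝ)..t, f s) (f t) t := fun t =>
      intervalIntegral.integral_hasDerivAt_right (hf.intervalIntegrable 0 t)
        (hf.stronglyMeasurableAtFilter _ _) hf.continuousAt
    have hg : ∀ t ∈ Set.Icc (0 : ℝ) 1,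
        HasDerivAt g (f t - -(1 / √(1 - (r * c t) ^ 2)) * (r * c' t)) t := by
      intro t ht
      have hl := abs_lt.1 ((sq_lt_one_iff_abs_lt_one _).1 (hlt t ht))
      have := HasDerivAt.comp (h₂ := Real.arccos) (h := fun t => r * c t) t
        (Real.hasDerivAt_arccos hl.1.ne' hl.2.ne) ((hc t).const_mul r)
      exact (hI t).sub this
    have hmono : MonotoneOn g (Set.Icc 0 1) := by
      refine monotoneOn_of_deriv_nonneg (convex_Icc 0 1)
        (fun t ht => (hg t ht).continuousAt.continuousWithinAt)
        (fun t ht => ((hg t (interior_subset ht)).differentiableAt).differentiableWithinAt) ?_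
      intro t ht
      have ht' := interior_subset ht
      rw [(hg t ht').deriv]
      have hpos : 0 < √(1 - (r * c t) ^ 2) := Real.sqrt_pos.2 (by linarith [hlt t ht'])
      have habs : |r * c' t| ≤ f t * √(1 - (r * c t) ^ 2) := by
        refine abs_le_of_sq_le_sq ?_ (mul_nonneg (hf0 t) hpos.le)
        rw [mul_pow (f t), Real.sq_sqrt (by linarith [hlt t ht']), mul_pow]
        have h1 := mul_le_mul_of_nonneg_left (hcf t ht') (sq_nonneg r)
        have h2 : 0 ≤ f t ^ 2 * (1 - r ^ 2) := mul_nonneg (sq_nonneg _) (by linarith)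
        nlinarith
      have h3 := (abs_le.1 habs).1
      have h4 : f t - -(1 / √(1 - (r * c t) ^ 2)) * (r * c' t) =
          (f t * √(1 - (r * c t) ^ 2) + r * c' t) / √(1 - (r * c t) ^ 2) := by
        rw [add_div, mul_div_cancel_right₀ _ hpos.ne']
        ring
      rw [h4]
      exact div_nonneg (by linarith) hpos.le
    have := hmono (Set.left_mem_Icc.2 zero_le_one) (Set.right_mem_Icc.2 zero_le_one) zero_le_one
    simp only [g, intervalIntegral.integral_same, h0, mul_one] at this
    linarith
  have ht : Filter.Tendsto (fun r : ℝ => Real.arccos (r * c 1) - Real.arccos r)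
      (nhdsWithin 1 (Set.Iio 1)) (nhds (Real.arccos (1 * c 1) - Real.arccos 1)) := by
    refine tendsto_nhdsWithin_of_tendsto_nhds (Continuous.tendsto ?_ 1)
    exact (Real.continuous_arccos.comp (continuous_id.mul continuous_const)).sub
      Real.continuous_arccos
  rw [one_mul, Real.arccos_one, sub_zero] at ht
  exact le_of_tendsto ht (Filter.mem_of_superset
    (Ioo_mem_nhdsLT zero_lt_one) key)

end Transport

section LowerBound

variable {n : Type*} [Fintype n]

lemma re_trace_mul_conjTranspose_comm {ρ : Matrix n n ℂ} (hρ : ρ.IsHermitian)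
    (A B : Matrix n n ℂ) : (A * ρ * Bᴴ).trace.re = (B * ρ * Aᴴ).trace.re := by
  have : (A * ρ * Bᴴ).trace = star (B * ρ * Aᴴ).trace := by
    rw [← Matrix.trace_conjTranspose]
    simp only [Matrix.conjTranspose_mul, Matrix.conjTranspose_conjTranspose, hρ.eq, mul_assoc]
  rw [this, RCLike.star_def, Complex.conj_re]

/-- Cauchy–Schwarz for the semi-inner product `Re tr A ρ B†`. -/
lemma re_trace_sq_le {ρ : Matrix n n ℂ} (hρ : ρ.PosSemidef) (A B : Matrix n n ℂ) :
    (A * ρ * Bᴴ).trace.re ^ 2 ≤ (A * ρ * Aᴴ).trace.re * (B * ρ * Bᴴ).trace.re := by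
  have h : ∀ x : ℝ, 0 ≤ (B * ρ * Bᴴ).trace.re * (x * x) + (2 * (A * ρ * Bᴴ).trace.re) * x
      + (A * ρ * Aᴴ).trace.re := by
    intro x
    have h1 := (Complex.nonneg_iff.1 (hρ.mul_mul_conjTranspose_same
      (A + (x : ℂ) • B)).trace_nonneg).1
    simp only [Matrix.conjTranspose_add, Matrix.conjTranspose_smul, add_mul, mul_add,
      Matrix.smul_mul, Matrix.mul_smul, Matrix.trace_add, Matrix.trace_smul, Complex.add_re,
      RCLike.star_def, Complex.conj_ofReal, smul_eq_mul, Complex.re_ofReal_mul] at h1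
    rw [re_trace_mul_conjTranspose_comm hρ.1 B A] at h1
    linarith
  have := discrim_le_zero h
  rw [discrim] at this
  linarith

lemma rldFisher_eq (ρ L : Matrix n n ℂ) : rldFisher ρ L = (L * ρ * Lᴴ).trace.re := by
  rw [rldFisher, mul_assoc, Matrix.trace_mul_comm]

variable {γ : ℝ → Matrix n n ℂ} {ρ σ : Matrix n n ℂ}

lemma IsSmoothPath.hasDerivWithinAt_apply (hγ : IsSmoothPath γ ρ σ) {t : ℝ}
    (ht : t ∈ Set.Icc (0 : ℝ) 1) (i j : n) :
    HasDerivWithinAt (fun s => γ s i j) (velocity γ t i j) (Set.Icc 0 1) t :=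
  (((hγ.smooth i j).differentiableOn (by simp)) t ht).hasDerivWithinAt

lemma IsSmoothPath.velocity_isHermitian (hγ : IsSmoothPath γ ρ σ) {t : ℝ}
    (ht : t ∈ Set.Icc (0 : ℝ) 1) : (velocity γ t).IsHermitian := by
  ext i j
  have h1 := (hγ.hasDerivWithinAt_apply ht j i).star
  have h2 : HasDerivWithinAt (fun s => γ s i j) (star (velocity γ t j i)) (Set.Icc 0 1) t :=
    h1.congr (fun s hs => ((hγ.state s hs).1.1.apply i j).symm)
      ((hγ.state t ht).1.1.apply i j).symm
  exact (uniqueDiffOn_Icc_zero_one t ht).eq_deriv _ h2 (hγ.hasDerivWithinAt_apply ht i j)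

lemma IsSmoothPath.trace_velocity (hγ : IsSmoothPath γ ρ σ) {t : ℝ}
    (ht : t ∈ Set.Icc (0 : ℝ) 1) : (velocity γ t).trace = 0 := by
  have h1 : HasDerivWithinAt (fun s => (γ s).trace) (velocity γ t).trace (Set.Icc 0 1) t :=
    HasDerivWithinAt.fun_sum fun i _ => hγ.hasDerivWithinAt_apply ht i i
  have h2 : HasDerivWithinAt (fun s => (γ s).trace) 0 (Set.Icc 0 1) t :=
    (hasDerivWithinAt_const t _ (1 : ℂ)).congr (fun s hs => (hγ.state s hs).2) (hγ.state t ht).2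
  exact (uniqueDiffOn_Icc_zero_one t ht).eq_deriv _ h1 h2

/-- The path, extended to be constant outside `[0, 1]`, together with its velocity is
continuous. -/
lemma IsSmoothPath.continuous_projIcc (hγ : IsSmoothPath γ ρ σ) :
    Continuous (fun t => γ (Set.projIcc (0 : ℝ) 1 zero_le_one t)) ∧
      Continuous (fun t => velocity γ (Set.projIcc (0 : ℝ) 1 zero_le_one t)) := by
  constructor
  · refine continuous_matrix fun i j => ?_
    exact (hγ.smooth i j).continuousOn.comp_continuous
      (continuous_subtype_val.comp _root_.continuous_projIcc) fun t => (Set.projIcc (0 : ℝ) 1 _ t).2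
  · refine continuous_matrix fun i j => ?_
    exact ((hγ.smooth i j).continuousOn_derivWithin uniqueDiffOn_Icc_zero_one
      (by simp)).comp_continuous
      (continuous_subtype_val.comp _root_.continuous_projIcc) fun t => (Set.projIcc (0 : ℝ) 1 _ t).2

open scoped Matrix.Norms.L2Operator in
lemma hasDerivWithinAt_matrix [DecidableEq n] {f : ℝ → Matrix n n ℂ} {f' : Matrix n n ℂ}
    {s : Set ℝ} {t : ℝ} (h : ∀ i j, HasDerivWithinAt (fun u => f u i j) (f' i j) s t) :
    HasDerivWithinAt f f' s t := by
  have e : ∀ M : Matrix n n ℂ, M = ∑ i, ∑ j, M i j • Matrix.single i j (1 : ℂ) := fun M => by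
    conv_lhs => rw [Matrix.matrix_eq_sum_single M]
    simp
  rw [e f', show f = fun u => ∑ i, ∑ j, f u i j • Matrix.single i j (1 : ℂ) from
    funext fun u => e (f u)]
  exact HasDerivWithinAt.fun_sum fun i _ => HasDerivWithinAt.fun_sum fun j _ =>
    (h i j).smul_const _

open scoped Matrix.Norms.L2Operator in
/-- A path with commuting RLDs produces a factor `N` with `σ = N² ρ`, `N ρ` Hermitian, and length
at least the angle `arccos tr N ρ`. -/
lemma exists_factor_of_commuting [DecidableEq n] {L : ℝ → Matrix n n ℂ}
    (hγ : IsSmoothPath γ ρ σ) (hL : ∀ t ∈ Set.Icc (0 : ℝ) 1, IsRLD γ t (L t))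
    (hc : ∀ s ∈ Set.Icc (0 : ℝ) 1, ∀ t ∈ Set.Icc (0 : ℝ) 1, L s * L t = L t * L s) :
    ∃ N : Matrix n n ℂ, σ = N * N * ρ ∧ (N * ρ).IsHermitian ∧
      Real.arccos (N * ρ).trace.re ≤ 1 / 2 * ∫ t in (0 : ℝ)..1, √(rldFisher (γ t) (L t)) := by
  let π : ℝ → ℝ := fun t => Set.projIcc (0 : ℝ) 1 zero_le_one t
  have hπ : ∀ t, π t ∈ Set.Icc (0 : ℝ) 1 := fun t => (Set.projIcc (0 : ℝ) 1 zero_le_one t).2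
  have hπid : ∀ t ∈ Set.Icc (0 : ℝ) 1, π t = t := fun t ht =>
    congrArg Subtype.val (Set.projIcc_of_mem zero_le_one ht)
  obtain ⟨hcγ, hcv⟩ := hγ.continuous_projIcc
  have hdet : ∀ t ∈ Set.Icc (0 : ℝ) 1, IsUnit (γ t).det := fun t ht =>
    (Matrix.isUnit_iff_isUnit_det _).1 (hγ.state t ht).1.isUnit
  have hLeq : ∀ t ∈ Set.Icc (0 : ℝ) 1, L t = velocity γ t * (γ t)⁻¹ := fun t ht => by
    rw [hL t ht, mul_assoc, Matrix.mul_nonsing_inv _ (hdet t ht), mul_one]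
  have hLc : Continuous fun t => L (π t) := by
    have e : (fun t => L (π t)) = fun t =>
        velocity γ (π t) * ((γ (π t)).det⁻¹ • (γ (π t)).adjugate) := by
      funext t
      rw [hLeq _ (hπ t), Matrix.inv_def, Ring.inverse_eq_inv']
    rw [e]
    exact hcv.mul ((hcγ.matrix_det.inv₀ fun t => (hdet _ (hπ t)).ne_zero).smul
      hcγ.matrix_adjugate)
  obtain ⟨N, hN0, hN, hNγ⟩ := exists_transport (ℓ := fun t => L (π t)) (γ := γ) hLc
    (fun s t => hc _ (hπ s) _ (hπ t))
    (fun t ht => by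
      rw [hπid t ht, ← hL t ht]
      exact hasDerivWithinAt_matrix fun i j => hγ.hasDerivWithinAt_apply ht i j)
    (fun t ht => by
      rw [hπid t ht, ← hL t ht]
      exact hγ.velocity_isHermitian ht)
    (fun t ht => (hγ.state t ht).1.1)
  rw [hγ.source] at hNγ
  have h0 : (0 : ℝ) ∈ Set.Icc (0 : ℝ) 1 := Set.left_mem_Icc.2 zero_le_one
  have h1 : (1 : ℝ) ∈ Set.Icc (0 : ℝ) 1 := Set.right_mem_Icc.2 zero_le_one
  have hρ : IsPosState ρ := hγ.source ▸ hγ.state 0 h0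
  have hNρ : ∀ t ∈ Set.Icc (0 : ℝ) 1, γ t = N t * ρ * (N t)ᴴ := fun t ht => by
    rw [(hNγ t ht).1, mul_assoc (N t) ρ, mul_assoc (N t) (N t) ρ, (hNγ t ht).2,
      Matrix.star_eq_conjTranspose]
  refine ⟨N 1, by rw [← hγ.target, (hNγ 1 h1).1], ?_, ?_⟩
  · rw [Matrix.IsHermitian, Matrix.conjTranspose_mul, hρ.1.1.eq, (hNγ 1 h1).2,
      Matrix.star_eq_conjTranspose]
  let c : ℝ → ℝ := fun t => (N t * ρ).trace.re
  let c' : ℝ → ℝ := fun t => 1 / 2 * (L (π t) * N t * ρ).trace.re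
  let f : ℝ → ℝ := fun t => 1 / 2 * √(rldFisher (γ (π t)) (L (π t)))
  have hfc : Continuous f := by
    refine continuous_const.mul (Real.continuous_sqrt.comp (Complex.continuous_re.comp ?_))
    exact ((hLc.matrix_conjTranspose.mul hLc).mul hcγ).matrix_trace
  have hcd : ∀ t, HasDerivAt c (c' t) t := by
    intro t
    let φ : Matrix n n ℂ →ₗ[ℝ] ℝ :=
      { toFun := fun M => (M * ρ).trace.re
        map_add' := fun A B => by simp [add_mul]
        map_smul' := fun x A => by simp }
    have := (LinearMap.toContinuousLinearMap φ).hasFDerivAt.comp_hasDerivAt t (hN t)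
    convert! this using 1
    simp [φ, c']
  have hip : ∀ t ∈ Set.Icc (0 : ℝ) 1, (N t * ρ * (N t)ᴴ).trace.re = 1 := fun t ht => by
    rw [← hNρ t ht, (hγ.state t ht).2, Complex.one_re]
  have hone : ((1 : Matrix n n ℂ) * ρ * (1 : Matrix n n ℂ)ᴴ).trace.re = 1 := by
    rw [one_mul, Matrix.conjTranspose_one, mul_one, hρ.2, Complex.one_re]
  have hmain : Real.arccos (c 1) ≤ ∫ t in (0 : ℝ)..1, f t := by
    refine arccos_le_integral_of_sphere hfc (fun t => by positivity) hcd ?_ ?_ ?_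
    · simp [c, hN0, hρ.2]
    · intro t ht
      have := re_trace_sq_le hρ.1.posSemidef (N t) 1
      rwa [hip t ht, hone, Matrix.conjTranspose_one, mul_one, one_mul] at this
    · intro t ht
      set A := L (π t) * N t with hA
      have hJ : (A * ρ * Aᴴ).trace.re = rldFisher (γ (π t)) (L (π t)) := by
        rw [rldFisher_eq, hπid t ht, hNρ t ht, hA, hπid t ht, Matrix.conjTranspose_mul]
        simp only [mul_assoc]
      have hJ0 : 0 ≤ rldFisher (γ (π t)) (L (π t)) := by
        rw [← hJ]
        exact (Complex.nonneg_iff.1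
          (hρ.1.posSemidef.mul_mul_conjTranspose_same A).trace_nonneg).1
      have hAN : (A * ρ * (N t)ᴴ).trace.re = 0 := by
        have : A * ρ * (N t)ᴴ = velocity γ t := by
          rw [hL t ht, hNρ t ht, hA, hπid t ht]
          simp only [mul_assoc]
        rw [this, hγ.trace_velocity ht, Complex.zero_re]
      have hcs := re_trace_sq_le hρ.1.posSemidef A (1 - (c t : ℂ) • N t)
      have hAB : (A * ρ * (1 - (c t : ℂ) • N t)ᴴ).trace.re = (A * ρ).trace.re := by
        simp only [Matrix.conjTranspose_sub, Matrix.conjTranspose_one, Matrix.conjTranspose_smul,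
          RCLike.star_def, Complex.conj_ofReal, mul_sub, mul_one, Matrix.mul_smul,
          Matrix.trace_sub, Matrix.trace_smul, smul_eq_mul, Complex.sub_re, Complex.re_ofReal_mul,
          hAN]
        ring
      have hBB : ((1 - (c t : ℂ) • N t) * ρ * (1 - (c t : ℂ) • N t)ᴴ).trace.re = 1 - c t ^ 2 := by
        have hsym := re_trace_mul_conjTranspose_comm hρ.1.1 1 (N t)
        simp only [Matrix.conjTranspose_one, mul_one, one_mul] at hsym
        simp only [Matrix.conjTranspose_sub, Matrix.conjTranspose_one, Matrix.conjTranspose_smul,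
          RCLike.star_def, Complex.conj_ofReal, mul_sub, sub_mul, mul_one, one_mul,
          Matrix.mul_smul, Matrix.smul_mul,
          Matrix.trace_sub, Matrix.trace_smul, smul_eq_mul, Complex.sub_re, Complex.re_ofReal_mul,
          hip t ht, hsym, hρ.2, Complex.one_re]
        simp only [c]
        ring
      rw [hAB, hBB, hJ] at hcs
      simp only [c', f, mul_pow, Real.sq_sqrt hJ0, ← hA]
      linarith
  refine hmain.trans (le_of_eq ?_)
  rw [← intervalIntegral.integral_const_mul]
  refine intervalIntegral.integral_congr fun t ht => ?_
  rw [Set.uIcc_of_le zero_le_one] at ht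
  simp only [f, hπid t ht]

end LowerBound

end QFid

theorem mainTheorem5 {n : Type*} [Fintype n] (ρ σ : Matrix n n ℂ)
    (hρ : QFid.IsPosState ρ) (hσ : QFid.IsPosState σ) :
    IsGreatest (QFid.reverseTestFidelities ρ σ) (QFid.Fmin ρ σ) ∧
      ∃ l : ℝ, IsLeast (QFid.commutingRLDLengths ρ σ) l ∧
        QFid.Fmin ρ σ = Real.cos l := by
  classical
  obtain ⟨S, d, hS, hd, rfl, rfl⟩ := QFid.exists_simultaneous_congruence hρ.1 hσ.1
  set F := (S * Matrix.diagonal (fun i => ((√(d i) : ℝ) : ℂ)) * Sᴴ).trace.re with hF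
  have hgreat : IsGreatest (QFid.reverseTestFidelities (S * Sᴴ)
      (S * Matrix.diagonal (fun i => (d i : ℂ)) * Sᴴ)) F := by
    refine ⟨QFid.exists_reverseTest hS hd hρ.2 hσ.2, ?_⟩
    rintro _ ⟨k, Φ, p, q, h, rfl⟩
    obtain ⟨X, hX, hX', htr⟩ := h.exists_schur hρ.1
    rw [← htr]
    exact QFid.trace_re_le_of_schur hS hd hX hX'
  have hFmin : QFid.Fmin (S * Sᴴ) (S * Matrix.diagonal (fun i => (d i : ℂ)) * Sᴴ) = F :=
    hgreat.csSup_eq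
  rw [hFmin]
  have hF0 : 0 ≤ F := by
    rw [hF, QFid.trace_congruence_diagonal, Complex.ofReal_re]
    exact Finset.sum_nonneg fun i _ =>
      mul_nonneg (Real.sqrt_nonneg _) (QFid.colNormSq_pos hS i).le
  have hF1 : F ≤ 1 := by
    obtain ⟨k, Φ, p, q, h, hf⟩ := hgreat.1
    rw [hf, QFid.classicalFidelity]
    calc ∑ x, √(p x) * √(q x) ≤ ∑ x, (p x + q x) / 2 := Finset.sum_le_sum fun x _ => by
          nlinarith [sq_nonneg (√(p x) - √(q x)), Real.sq_sqrt (h.prob_left.1 x),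
            Real.sq_sqrt (h.prob_right.1 x)]
      _ = 1 := by
          rw [← Finset.sum_div, Finset.sum_add_distrib, h.prob_left.2, h.prob_right.2]
          norm_num
  refine ⟨hgreat, Real.arccos F, ⟨QFid.exists_commuting_path hS hd hρ.2 hσ.2, ?_⟩,
    (Real.cos_arccos (by linarith) hF1).symm⟩
  rintro _ ⟨γ, L, hγ, hL, hc, rfl⟩
  obtain ⟨N, hN, hNH, hle⟩ := QFid.exists_factor_of_commuting hγ hL hc
  refine (Real.arccos_le_arccos (QFid.trace_re_le_of_schur hS hd hNH ?_)).trans hle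
  have hdet := (Matrix.isUnit_iff_isUnit_det _).1 hρ.1.isUnit
  rw [mul_assoc N, Matrix.mul_nonsing_inv _ hdet, mul_one, ← mul_assoc N, ← hN, sub_self]
  exact Matrix.PosSemidef.zero
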